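/- For $M>0$ let $B(0,M)=\{w\in\mathbb R^2 : |w|<M\}$ (Euclidean norm), and let $R(x,y)=\frac1{\sqrt2}(x+y,\,-x+y)$ be the rotation of angle $-\pi/4$. A set $\Sigma\subset\mathbb R^2$ is a \emph{damping set} if $(0,0)\in\Sigma$, if $xy\ge 0$ for every $(x,y)\in\Sigma$, and if $R\Sigma$ contains the graph of a universally measurable function $\varphi:\mathbb R\to\mathbb R$ with $|\varphi(x)|\le a|x|+b$ for all $x\in\mathbb R$, for some $a,b\ge0$. For $p\in[1,+\infty]$ let $\mathsf X_p=W^{1,p}_*(0,1)\times L^p(0,1)$, where $W^{1,p}_*(0,1)$ is the set of absolutely continuous $u:[0,1]\to\mathbb R$ with $u(0)=0$ and $u'\in L^p(0,1)$, with the norm $$\|(u,v)\|_{\mathsf X_p}^p=2^{-p/2}\int_0^1\left(|u'+v|^p+|u'-v|^p\right)dx\quad(p<\infty),$$ $$\|(u,v)\|_{\mathsf X_\infty}=\tfrac1{\sqrt2}\max\left(\|u'+v\|_{L^\infty(0,1)},\|u'-v\|_{L^\infty(0,1)}\right).$$ A function $z:\mathbb R_+\times[0,1]\to\mathbb R$ is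 a \emph{solution in $\mathsf X_p$} of the wave equation $z_{tt}=z_{xx}$, $z(t,0)=0$, $(z_t(t,1),-z_x(t,1))\in\Sigma$, with initial condition $(z_0,z_1)\in\mathsf X_p$, if there are $f,g$ with $f\in L^p(0,T)$ and $g\in L^p(-1,T)$ for every finite $T$, such that $$z(t,x)=\frac1{\sqrt2}\int_0^{t+x}f(s)\,ds+\frac1{\sqrt2}\int_0^{t-x}g(s)\,ds\qquad\text{for all }(t,x)\in\mathbb R_+\times[0,1],$$ $z(t,0)=0$ and $(z_t(t,1),-z_x(t,1))\in\Sigma$ for a.e. $t\ge0$, and $z(0,x)=z_0(x)$, $z_t(0,x)=z_1(x)$ for a.e. $x\in[0,1]$. Its energy is $e_p(z)(t)=\|(z(t,\cdot),z_t(t,\cdot))\|_{\mathsf X_p}$. It is nontrivial if it is not identically zero. \textbf{Statement.} Let $\Sigma$ be a damping set and let $M,a,b>0$ be such that $a|x|\le|y|\le b|x|$ for every $(x,y)\in\Sigma\setminus B(0,M)$. Assume that $\Sigma\cap\{(x,x):x\in\mathbb R\}=\{(0,0)\}$, and that there is a function $q\in C^1(\mathbb R_+,\mathbb R_+)$ with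 $q(0)=q'(0)=0$, and with $0<q(x)<x$ and $|q'(x)|<1$ for every $x>0$, such that $$|y|=q(|x|)\quad\text{or}\quad|x|=q(|y|)\qquad\text{for every }(x,y)\in\Sigma\cap B(0,M).$$ Let $Q:\mathbb R_+\to\mathbb R_+$ be defined by $$Q(x)=\frac1{\sqrt2}\left[2\,(q+\mathrm{id})^{-1}(\sqrt2\,x)-\sqrt2\,x\right],$$ where $(q+\mathrm{id})^{-1}$ is the inverse of the bijection $x\mapsto q(x)+x$ of $\mathbb R_+$, and let $Q^{[n]}$ be its $n$-th iterate. Then, for every $p\in[1,+\infty]$ and every nontrivial solution $z$ in $\mathsf X_p$, there exist constants $C_1,C_2>0$ such that, for every $t\ge0$, $$C_1\,Q^{[\lfloor t/2\rfloor]}(1)\le e_p(z)(t)\le C_2\,Q^{[\lfloor t/2\rfloor]}(1).$$ -/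

import Mathlib

open scoped ENNReal
open MeasureTheory

namespace BoundaryDamping

/-- The open Euclidean ball of `ℝ²` centred at the origin (the norm of `ℝ × ℝ` in Mathlib is the
sup norm, so the Euclidean norm is written out). -/
def ball (M : ℝ) : Set (ℝ × ℝ) := {w | Real.sqrt (w.1 ^ 2 + w.2 ^ 2) < M}

/-- The rotation `R` of the plane of angle `-π/4`. -/
noncomputable def rot (w : ℝ × ℝ) : ℝ × ℝ :=
  (w.1 / Real.sqrt 2 + w.2 / Real.sqrt 2, -w.1 / Real.sqrt 2 + w.2 / Real.sqrt 2)

/-- A function `φ : ℝ → ℝ` is universally measurable if the preimage of every Borel set is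
`μ`-measurable for every Borel probability measure `μ` on `ℝ`. -/
def UniversallyMeasurable (φ : ℝ → ℝ) : Prop :=
  ∀ μ : Measure ℝ, IsProbabilityMeasure μ → NullMeasurable φ μ

def LinearGrowth (φ : ℝ → ℝ) : Prop :=
  ∃ a b : ℝ, 0 ≤ a ∧ 0 ≤ b ∧ ∀ x, |φ x| ≤ a * |x| + b

/-- A damping set: it contains the origin, its image under `R` contains the graph of a universally
measurable function with linear growth, and `x y ≥ 0` for all its points `(x, y)`. -/
structure IsDamping (S : Set (ℝ × ℝ)) : Prop where
  zero_mem : ((0 : ℝ), (0 : ℝ)) ∈ S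
  exists_graph : ∃ φ : ℝ → ℝ, UniversallyMeasurable φ ∧ LinearGrowth φ ∧
    ∀ x, (x, φ x) ∈ rot '' S
  mul_nonneg : ∀ w ∈ S, 0 ≤ w.1 * w.2

/-- The linear sector condition at infinity, with radius `M`. -/
def SectorAtInfinity (S : Set (ℝ × ℝ)) (M : ℝ) : Prop :=
  (∀ w ∈ S, 0 ≤ w.1 * w.2) ∧ 0 < M ∧
    ∃ a b : ℝ, 0 < a ∧ 0 < b ∧ ∀ w ∈ S \ ball M, a * |w.1| ≤ |w.2| ∧ |w.2| ≤ b * |w.1|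

/-- `q ∈ C¹(ℝ₊, ℝ₊)` with `q(0) = q'(0) = 0`, `0 < q(x) < x` and `|q'(x)| < 1` for `x > 0`.
Only the values of `q` on `[0, ∞)` matter; the derivative at `0` is one-sided. -/
structure IsProfile (q : ℝ → ℝ) : Prop where
  contDiffOn : ContDiffOn ℝ 1 q (Set.Ici 0)
  map_zero : q 0 = 0
  deriv_zero : derivWithin q (Set.Ici 0) 0 = 0
  pos : ∀ x, 0 < x → 0 < q x
  lt_self : ∀ x, 0 < x → q x < x
  abs_deriv_lt : ∀ x, 0 < x → |derivWithin q (Set.Ici 0) x| < 1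

/-- The inverse of `q + id : [0, ∞) → [0, ∞)`. -/
noncomputable def invAddId (q : ℝ → ℝ) : ℝ → ℝ :=
  Function.invFunOn (fun y => q y + y) (Set.Ici 0)

/-- `q + id` is a bijection of `[0, ∞)`, so that `invAddId q` is indeed its inverse there. -/
theorem IsProfile.bijOn {q : ℝ → ℝ} (hq : IsProfile q) :
    Set.BijOn (fun y => q y + y) (Set.Ici 0) (Set.Ici 0) := by
  have hnn : ∀ y, 0 ≤ y → 0 ≤ q y := by
    intro y hy
    rcases hy.eq_or_lt with h | h
    · rw [← h, hq.map_zero]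
    · exact (hq.pos y h).le
  have hc : ContinuousOn (fun y => q y + y) (Set.Ici 0) :=
    hq.contDiffOn.continuousOn.add continuousOn_id
  have hd : DifferentiableOn ℝ q (Set.Ici 0) := hq.contDiffOn.differentiableOn (by norm_num)
  refine ⟨fun y hy => add_nonneg (hnn y hy) hy, ?_, ?_⟩
  · refine (strictMonoOn_of_deriv_pos (convex_Ici 0) hc ?_).injOn
    intro x hx
    rw [interior_Ici] at hx
    have hx' : (0 : ℝ) < x := hx
    have hn : Set.Ici (0 : ℝ) ∈ nhds x := Ici_mem_nhds hx'
    have hdx : DifferentiableAt ℝ q x := (hd x hx'.le).differentiableAt hn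
    have h1 := hq.abs_deriv_lt x hx'
    rw [derivWithin_of_mem_nhds hn] at h1
    have h2 := (hdx.hasDerivAt.add (hasDerivAt_id x)).deriv
    have h3 : deriv (fun y => q y + y) x = deriv q x + 1 := h2
    rw [h3]
    linarith [(abs_lt.mp h1).1]
  · intro v hv
    have hv' : (0 : ℝ) ≤ v := hv
    have hsub : Set.Icc ((fun y => q y + y) 0) ((fun y => q y + y) v) ⊆
        (fun y => q y + y) '' Set.Icc 0 v :=
      intermediate_value_Icc hv' (hc.mono Set.Icc_subset_Ici_self)
    obtain ⟨y, hy, hyv⟩ := hsub ⟨by simpa [hq.map_zero] using hv',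
      by simpa using hnn v hv'⟩
    exact ⟨y, hy.1, hyv⟩

/-- `Q(x) = (1/√2) (2 (q + id)⁻¹(√2 x) - √2 x)`. -/
noncomputable def transform (q : ℝ → ℝ) (x : ℝ) : ℝ :=
  (1 / Real.sqrt 2) * (2 * invAddId q (Real.sqrt 2 * x) - Real.sqrt 2 * x)

/-- `f ∈ Lᵖ_loc(a, +∞)`, in the sense that `f ∈ Lᵖ(a, T)` for every finite `T`. -/
def MemLpLoc (p : ℝ≥0∞) (a : ℝ) (f : ℝ → ℝ) : Prop :=
  ∀ T : ℝ, MemLp f p (volume.restrict (Set.Ioo a T))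

/-- `(u, v) ∈ X_p = W^{1,p}_*(0,1) × Lᵖ(0,1)`, where `W^{1,p}_*(0,1)` is the space of absolutely
continuous functions on `[0, 1]` vanishing at `0` with derivative in `Lᵖ(0,1)`. -/
def MemX (p : ℝ≥0∞) (u v : ℝ → ℝ) : Prop :=
  AbsolutelyContinuousOnInterval u 0 1 ∧ u 0 = 0 ∧
    MemLp (deriv u) p (volume.restrict (Set.Ioo 0 1)) ∧
    MemLp v p (volume.restrict (Set.Ioo 0 1))

/-- The norm of `(u, v)` in `X_p`, with values in `[0, ∞]`. -/
noncomputable def normX (p : ℝ≥0∞) (u v : ℝ → ℝ) : ℝ≥0∞ :=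
  if p = ∞ then
    ENNReal.ofReal (1 / Real.sqrt 2) *
      max (essSup (fun x => ‖deriv u x + v x‖ₑ) (volume.restrict (Set.Ioo 0 1)))
        (essSup (fun x => ‖deriv u x - v x‖ₑ) (volume.restrict (Set.Ioo 0 1)))
  else
    (ENNReal.ofReal (1 / (2 : ℝ) ^ (p.toReal / 2)) *
      ∫⁻ x in Set.Ioo (0 : ℝ) 1,
        (‖deriv u x + v x‖ₑ ^ p.toReal + ‖deriv u x - v x‖ₑ ^ p.toReal)) ^ (1 / p.toReal)

/-- The time derivative `z_t(t, x)` of a function on `ℝ₊ × [0, 1]` (one-sided at `t = 0`). -/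
noncomputable def timeDeriv (z : ℝ → ℝ → ℝ) (t x : ℝ) : ℝ :=
  derivWithin (fun s => z s x) (Set.Ici 0) t

/-- `z : ℝ₊ × [0, 1] → ℝ` is a weak global solution in `X_p`, with initial condition `(z₀, z₁)`, of
`z_tt = z_xx`, `z(t, 0) = 0`, `(z_t(t, 1), -z_x(t, 1)) ∈ S`. Only the values `z t x` with `t ≥ 0` and
`x ∈ [0, 1]` matter; for a function of the d'Alembert form below the derivatives that occur exist
for almost every parameter. -/
def IsWeakSolution (p : ℝ≥0∞) (S : Set (ℝ × ℝ)) (z₀ z₁ : ℝ → ℝ) (z : ℝ → ℝ → ℝ) : Prop :=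
  MemX p z₀ z₁ ∧
  ∃ f g : ℝ → ℝ, MemLpLoc p 0 f ∧ MemLpLoc p (-1) g ∧
    (∀ t : ℝ, 0 ≤ t → ∀ x ∈ Set.Icc (0 : ℝ) 1,
      z t x = (1 / Real.sqrt 2) * (∫ s in (0 : ℝ)..(t + x), f s) +
        (1 / Real.sqrt 2) * ∫ s in (0 : ℝ)..(t - x), g s) ∧
    (∀ᵐ t ∂(volume.restrict (Set.Ici (0 : ℝ))), z t 0 = 0) ∧
    (∀ᵐ t ∂(volume.restrict (Set.Ici (0 : ℝ))), ∃ a b : ℝ,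
      HasDerivWithinAt (fun s => z s 1) a (Set.Ici 0) t ∧
      HasDerivWithinAt (fun x => z t x) b (Set.Icc 0 1) 1 ∧
      (a, -b) ∈ S) ∧
    (∀ᵐ x ∂(volume.restrict (Set.Icc (0 : ℝ) 1)), z 0 x = z₀ x) ∧
    (∀ᵐ x ∂(volume.restrict (Set.Icc (0 : ℝ) 1)),
      HasDerivWithinAt (fun s => z s x) (z₁ x) (Set.Ici 0) 0)

/-- The energy `e_p(z)(t) = ‖(z(t, ·), z_t(t, ·))‖_{X_p}`. -/
noncomputable def energy (p : ℝ≥0∞) (z : ℝ → ℝ → ℝ) (t : ℝ) : ℝ≥0∞ :=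
  normX p (z t) (timeDeriv z t)

/-- The solution is not identically zero on `ℝ₊ × [0, 1]`. -/
def Nontrivial (z : ℝ → ℝ → ℝ) : Prop :=
  ∃ t : ℝ, 0 ≤ t ∧ ∃ x ∈ Set.Icc (0 : ℝ) 1, z t x ≠ 0

end BoundaryDamping

/-! The condition `z(t, 0) = 0` leaves a single profile `g`, with `z_x + z_t = -√2 g(t + x)` and
`z_x - z_t = -√2 g(t - x)` almost everywhere. The energy at time `t` is therefore the `Lᵖ` norm of
`g` on `(t - 1, t + 1)`, and the boundary condition reads `(g(t - 1), g(t + 1)) ∈ RΣ`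
(`exists_profile`, `energy_eq`).

Since `xy ≥ 0` on `Σ`, the rotated coordinates have absolute values `(|x| + |y|)/√2` and `||y| -
|x||/√2`. Inside the ball, if `u` is the larger of `|x|, |y|`, these are `(u + q u)/√2` and `(u - q
u)/√2`, a point of the graph of `Q`. So `|g(s + 2n)|` is, for almost every `s`, an orbit of `Q` once
it is small. Large values contract geometrically by the sector condition, and the diagonal condition
forbids reaching zero in finite time (`exists_isStep`).

As `q'(0) = 0`, `Q` is tangent to the identity at `0`, so its orbits decay more slowly than any
geometric sequence. A bounded delay costs only a constant factor, all positive orbits are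
comparable, and the geometric transient at large amplitude is absorbed at a cost linear in the
initial value (`orbit_le`). This linear bound is integrable in `Lᵖ` and gives the upper estimate.
For the lower one, the constants of `le_orbit` depend on `s`, but are bounded below on a set of
positive measure. -/

namespace BoundaryDamping

/-! ### Orbits of maps tangent to the identity at the origin. -/

/-- A monotone self-map of `[0, ∞)` with `0 < T x < x` away from `0`, uniformly contracting away
from `0` on bounded sets, and tangent to the identity at `0`. -/
structure SlowMap (T : ℝ → ℝ) : Prop where
  map_zero : T 0 = 0
  pos : ∀ x, 0 < x → 0 < T x
  lt_self : ∀ x, 0 < x → T x < x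
  mono : ∀ x y, 0 ≤ x → x ≤ y → T x ≤ T y
  contract : ∀ m M : ℝ, 0 < m → ∃ l, 0 < l ∧ l < 1 ∧ ∀ x, m ≤ x → x ≤ M → T x ≤ l * x
  ratio : ∀ l : ℝ, l < 1 → ∃ δ, 0 < δ ∧ ∀ x, 0 ≤ x → x ≤ δ → l * x ≤ T x

namespace SlowMap

variable {T : ℝ → ℝ}

lemma nonneg (h : SlowMap T) {x : ℝ} (hx : 0 ≤ x) : 0 ≤ T x := by
  rcases hx.eq_or_lt with rfl | hx
  · exact h.map_zero.ge
  · exact (h.pos x hx).le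

lemma le_self (h : SlowMap T) {x : ℝ} (hx : 0 ≤ x) : T x ≤ x := by
  rcases hx.eq_or_lt with rfl | hx
  · exact h.map_zero.le
  · exact (h.lt_self x hx).le

lemma iterate_pos (h : SlowMap T) {x : ℝ} (hx : 0 < x) (n : ℕ) : 0 < T^[n] x := by
  induction n with
  | zero => exact hx
  | succ n ih => rw [Function.iterate_succ_apply']; exact h.pos _ ih

lemma iterate_zero (h : SlowMap T) (n : ℕ) : T^[n] 0 = 0 :=
  Function.iterate_fixed h.map_zero n

lemma iterate_nonneg (h : SlowMap T) {x : ℝ} (hx : 0 ≤ x) (n : ℕ) : 0 ≤ T^[n] x := by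
  rcases hx.eq_or_lt with rfl | hx
  · exact (h.iterate_zero n).ge
  · exact (h.iterate_pos hx n).le

lemma iterate_antitone (h : SlowMap T) {x : ℝ} (hx : 0 ≤ x) : Antitone fun n => T^[n] x := by
  refine antitone_nat_of_succ_le fun n => ?_
  rw [Function.iterate_succ_apply']
  exact h.le_self (h.iterate_nonneg hx n)

lemma iterate_mono (h : SlowMap T) {x y : ℝ} (hx : 0 ≤ x) (hxy : x ≤ y) (n : ℕ) :
    T^[n] x ≤ T^[n] y := by
  induction n with
  | zero => exact hxy
  | succ n ih =>
    rw [Function.iterate_succ_apply', Function.iterate_succ_apply']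
    exact h.mono _ _ (h.iterate_nonneg hx n) ih

lemma exists_iterate_le (h : SlowMap T) {x m : ℝ} (hx : 0 ≤ x) (hm : 0 < m) :
    ∃ n, T^[n] x ≤ m := by
  by_contra! hcon
  obtain ⟨l, hl0, hl1, hl⟩ := h.contract m x hm
  have key : ∀ n, T^[n] x ≤ l ^ n * x := by
    intro n
    induction n with
    | zero => simp
    | succ n ih =>
      rw [Function.iterate_succ_apply', pow_succ']
      have := hl _ (hcon n).le (h.iterate_antitone hx (Nat.zero_le n))
      nlinarith
  obtain ⟨n, hn⟩ := exists_pow_lt_of_lt_one (show 0 < m / (x + 1) by positivity) hl1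
  have h1 := key n
  have h2 := hcon n
  rw [lt_div_iff₀ (by positivity)] at hn
  nlinarith [pow_pos hl0 n]

/-- Iterates decay more slowly than any geometric sequence. -/
lemma iterate_add_ge (h : SlowMap T) {x l : ℝ} (hx : 0 < x) (hl0 : 0 < l) (hl1 : l < 1) :
    ∃ c, 0 < c ∧ ∀ i k, c * l ^ k * T^[i] x ≤ T^[i + k] x := by
  obtain ⟨δ, hδ, hr⟩ := h.ratio l hl1
  obtain ⟨N, hN⟩ := h.exists_iterate_le hx.le hδ
  have late : ∀ i, N ≤ i → ∀ k, l ^ k * T^[i] x ≤ T^[i + k] x := by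
    intro i hi k
    induction k with
    | zero => simp
    | succ k ih =>
      have := hr (T^[i + k] x) (h.iterate_nonneg hx.le _)
        ((h.iterate_antitone hx.le (by omega : N ≤ i + k)).trans hN)
      rw [← add_assoc, Function.iterate_succ_apply', pow_succ']
      nlinarith
  have hNpos := h.iterate_pos hx N
  have hc1 : T^[N] x / x ≤ 1 := by
    rw [div_le_one hx]; exact h.iterate_antitone hx.le (Nat.zero_le N)
  -- The orbit is in the region `T y ≥ l * y` from time `N` on. Earlier terms are at most `x`, so
  -- this constant brings them below `T^[N] x`.
  refine ⟨T^[N] x / x, by positivity, fun i k => ?_⟩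
  have hi0 := h.iterate_pos hx i
  have hix : T^[i] x ≤ x := h.iterate_antitone hx.le (Nat.zero_le i)
  have hlk : l ^ k ≤ 1 := pow_le_one₀ hl0.le hl1.le
  have hlk0 : 0 < l ^ k := pow_pos hl0 k
  rcases le_total N i with hi | hi
  · refine le_trans ?_ (late i hi k)
    have : 0 < l ^ k * T^[i] x := by positivity
    nlinarith
  · have hle : T^[N] x / x * T^[i] x ≤ T^[N] x := by
      rw [div_mul_eq_mul_div, div_le_iff₀ hx]
      exact mul_le_mul_of_nonneg_left hix hNpos.le
    have h1 : T^[N] x / x * l ^ k * T^[i] x ≤ l ^ k * T^[N] x := by nlinarith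
    refine h1.trans ?_
    rcases le_total (i + k) N with hk | hk
    · exact (mul_le_of_le_one_left hNpos.le hlk).trans (h.iterate_antitone hx.le hk)
    · have h2 := late N le_rfl (i + k - N)
      rw [Nat.add_sub_cancel' hk] at h2
      refine le_trans (mul_le_mul_of_nonneg_right ?_ hNpos.le) h2
      exact pow_le_pow_of_le_one hl0.le hl1.le (by omega)

/-- Any two orbits are comparable. -/
lemma iterate_le_mul (h : SlowMap T) {x y : ℝ} (hx : 0 ≤ x) (hy : 0 < y) :
    ∃ C, 0 < C ∧ ∀ n, T^[n] x ≤ C * T^[n] y := by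
  rcases hx.eq_or_lt with rfl | hx
  · refine ⟨1, one_pos, fun n => ?_⟩
    rw [h.iterate_zero, one_mul]; exact h.iterate_nonneg hy.le n
  obtain ⟨j, hj⟩ := h.exists_iterate_le hx.le hy
  -- After `j` steps the first orbit is below the second; the delay `j` is fixed, so any rate in
  -- `(0, 1)` would do.
  obtain ⟨c, hc, hr⟩ := h.iterate_add_ge hx (l := 1 / 2) (by norm_num) (by norm_num)
  have hcj : 0 < c * (1 / 2 : ℝ) ^ j := by positivity
  refine ⟨1 / (c * (1 / 2 : ℝ) ^ j), by positivity, fun n => ?_⟩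
  have h1 := h.iterate_mono (h.iterate_nonneg hx.le j) hj n
  rw [← Function.iterate_add_apply] at h1
  have h2 := (hr n j).trans h1
  rw [div_mul_eq_mul_div, one_mul, le_div_iff₀ hcj]
  linarith

end SlowMap

/-- One step of the reflected wave: the map `T` at small amplitudes `x < m`, a contraction of
factor `l` at large amplitudes, and no extinction. -/
def IsStep (T : ℝ → ℝ) (m l x y : ℝ) : Prop :=
  (x < m → y = T x) ∧ (m ≤ x → y ≤ l * x) ∧ (y = 0 → x = 0)

namespace SlowMap

variable {T : ℝ → ℝ} {m l : ℝ}

/-- A longer stay above `m` requires a geometrically larger `X 0`, and this offsets the steps of `T`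
lost meanwhile. `C` does not depend on the orbit and the bound is affine in `X 0`, so that it can be
integrated over starting points. -/
lemma orbit_le (h : SlowMap T) (hm : 0 < m) (hl0 : 0 < l) (hl1 : l < 1) :
    ∃ C, 0 < C ∧ ∀ X : ℕ → ℝ, (∀ n, 0 ≤ X n) → (∀ n, IsStep T m l (X n) (X (n + 1))) →
      ∀ n, X n ≤ C * (1 + X 0) * T^[n] 1 := by
  obtain ⟨c, hc, hr⟩ := h.iterate_add_ge one_pos hl0 hl1
  obtain ⟨D, hD, hcmp⟩ := h.iterate_le_mul hm.le one_pos
  refine ⟨1 / c + D / c + D / (c * (l * m)), by positivity, fun X hX hstep n => ?_⟩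
  -- Here `k` is the time of entry below `m`. If `k > 0`, then `m ≤ X (k - 1) ≤ l ^ (k - 1) * X 0`,
  -- hence the extra factor `l` in `l * m`.
  have key : ∀ n, (m ≤ X n ∧ X n ≤ l ^ n * X 0) ∨
      ∃ k ≤ n, X n < m ∧ X n ≤ T^[n - k] m ∧ (k = 0 ∨ l * m ≤ l ^ k * X 0) := by
    intro n
    induction n with
    | zero =>
      rcases le_or_gt m (X 0) with h0 | h0
      · left; simpa using h0
      · right; exact ⟨0, le_rfl, h0, by simpa using h0.le, Or.inl rfl⟩
    | succ n ih =>
      rcases ih with ⟨h1, h2⟩ | ⟨k, hk, h1, h2, h3⟩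
      · have h4 := (hstep n).2.1 h1
        have h5 : X (n + 1) ≤ l ^ (n + 1) * X 0 := by rw [pow_succ']; nlinarith
        rcases le_or_gt m (X (n + 1)) with h0 | h0
        · left; exact ⟨h0, h5⟩
        · right
          refine ⟨n + 1, le_rfl, h0, by simpa using h0.le, Or.inr ?_⟩
          rw [pow_succ']; nlinarith
      · right
        have h4 := (hstep n).1 h1
        refine ⟨k, by omega, ?_, ?_, h3⟩
        · rw [h4]; exact (h.le_self (hX n)).trans_lt h1
        · rw [h4, Nat.succ_sub hk, Function.iterate_succ_apply']
          exact h.mono _ _ (hX n) h2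
  have hX0 := hX 0
  have hT := h.iterate_pos one_pos n
  rcases key n with ⟨-, h2⟩ | ⟨k, hk, -, h2, h3⟩
  · have h4 : c * l ^ n ≤ T^[n] 1 := by simpa using hr 0 n
    calc X n ≤ 1 / c * X 0 * (c * l ^ n) := by
          rw [show 1 / c * X 0 * (c * l ^ n) = l ^ n * X 0 by field_simp]
          exact h2
      _ ≤ 1 / c * X 0 * T^[n] 1 := by gcongr
      _ ≤ (1 / c + D / c + D / (c * (l * m))) * (1 + X 0) * T^[n] 1 := by
          have : 0 ≤ D / c := by positivity
          have : 0 ≤ D / (c * (l * m)) := by positivity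
          gcongr <;> linarith
  · have h4 := hcmp (n - k)
    have h5 := hr (n - k) k
    rw [Nat.sub_add_cancel hk] at h5
    have h6 := h2.trans h4
    rcases h3 with rfl | h3
    · calc X n ≤ D / c * 1 * (c * l ^ 0 * T^[n - 0] 1) := by
            rw [show D / c * 1 * (c * l ^ 0 * T^[n - 0] 1) = D * T^[n - 0] 1 by field_simp]
            exact h6
        _ ≤ D / c * 1 * T^[n] 1 := by gcongr
        _ ≤ (1 / c + D / c + D / (c * (l * m))) * (1 + X 0) * T^[n] 1 := by
            have : 0 ≤ 1 / c := by positivity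
            have : 0 ≤ D / (c * (l * m)) := by positivity
            gcongr <;> linarith
    · calc X n ≤ D / (c * (l * m)) * (l * m) * (c * T^[n - k] 1) := by
            rw [show D / (c * (l * m)) * (l * m) * (c * T^[n - k] 1) = D * T^[n - k] 1 by
              field_simp]
            exact h6
        _ ≤ D / (c * (l * m)) * (l ^ k * X 0) * (c * T^[n - k] 1) := by
            have := h.iterate_nonneg zero_le_one (n - k)
            gcongr
        _ = D / (c * (l * m)) * X 0 * (c * l ^ k * T^[n - k] 1) := by ring
        _ ≤ D / (c * (l * m)) * X 0 * T^[n] 1 := by gcongr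
        _ ≤ (1 / c + D / c + D / (c * (l * m))) * (1 + X 0) * T^[n] 1 := by
            have : 0 ≤ 1 / c := by positivity
            have : 0 ≤ D / c := by positivity
            gcongr <;> linarith

/-- Positivity persists, and contraction forces entry below `m`; from then on the sequence is an
exact orbit of `T`, comparable to that of `1`. The finitely many earlier terms have a positive
minimum. -/
lemma le_orbit (h : SlowMap T) (hl0 : 0 < l) (hl1 : l < 1) (hm : 0 < m)
    {X : ℕ → ℝ} (hX : ∀ n, 0 ≤ X n)
    (hstep : ∀ n, IsStep T m l (X n) (X (n + 1))) (h0 : X 0 ≠ 0) :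
    ∃ c, 0 < c ∧ ∀ n, c * T^[n] 1 ≤ X n := by
  have hpos : ∀ n, 0 < X n := by
    intro n
    refine lt_of_le_of_ne (hX n) (Ne.symm ?_)
    induction n with
    | zero => exact h0
    | succ n ih => exact fun h1 => ih ((hstep n).2.2 h1)
  have hk : ∃ k, X k < m := by
    by_contra! hcon
    have key : ∀ n, X n ≤ l ^ n * X 0 := by
      intro n
      induction n with
      | zero => simp
      | succ n ih => have := (hstep n).2.1 (hcon n); rw [pow_succ']; nlinarith
    obtain ⟨n, hn⟩ := exists_pow_lt_of_lt_one (div_pos hm (hpos 0)) hl1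
    rw [lt_div_iff₀ (hpos 0)] at hn
    linarith [key n, hcon n]
  obtain ⟨k, hk⟩ := hk
  have tail : ∀ j, X (k + j) < m ∧ X (k + j) = T^[j] (X k) := by
    intro j
    induction j with
    | zero => exact ⟨hk, rfl⟩
    | succ j ih =>
      have := (hstep (k + j)).1 ih.1
      rw [← add_assoc, this, Function.iterate_succ_apply', ← ih.2]
      exact ⟨(h.le_self (hX _)).trans_lt ih.1, rfl⟩
  obtain ⟨C, hC, hcmp⟩ := h.iterate_le_mul zero_le_one (hpos k)
  have fin : ∀ K : ℕ, ∃ c, 0 < c ∧ ∀ n < K, c ≤ X n := by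
    intro K
    induction K with
    | zero => exact ⟨1, one_pos, fun n hn => absurd hn (Nat.not_lt_zero n)⟩
    | succ K ih =>
      obtain ⟨c, hc, h1⟩ := ih
      refine ⟨min c (X K), lt_min hc (hpos K), fun n hn => ?_⟩
      rcases Nat.lt_succ_iff_lt_or_eq.mp hn with h2 | rfl
      · exact (min_le_left _ _).trans (h1 n h2)
      · exact min_le_right _ _
  obtain ⟨d, hd, hfin⟩ := fin k
  refine ⟨min d (1 / C), by positivity, fun n => ?_⟩
  have hT := h.iterate_pos one_pos n
  rcases lt_or_ge n k with hn | hn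
  · have h1 : T^[n] 1 ≤ 1 := h.iterate_antitone zero_le_one (Nat.zero_le n)
    calc min d (1 / C) * T^[n] 1 ≤ d * 1 := by gcongr; exact min_le_left _ _
      _ ≤ X n := by rw [mul_one]; exact hfin n hn
  · obtain ⟨j, rfl⟩ := Nat.exists_eq_add_of_le hn
    rw [(tail j).2]
    have h1 : T^[k + j] 1 ≤ T^[j] 1 := h.iterate_antitone zero_le_one (Nat.le_add_left j k)
    calc min d (1 / C) * T^[k + j] 1 ≤ 1 / C * (C * T^[j] (X k)) := by
          gcongr
          · exact min_le_right _ _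
          · exact h1.trans (hcmp j)
      _ = T^[j] (X k) := by field_simp

end SlowMap

end BoundaryDamping

/-! ### The map `Q` and the rotated damping set. -/

namespace BoundaryDamping

namespace IsProfile

variable {q : ℝ → ℝ}

lemma nonneg (hq : IsProfile q) {u : ℝ} (hu : 0 ≤ u) : 0 ≤ q u := by
  rcases hu.eq_or_lt with rfl | h
  · exact hq.map_zero.ge
  · exact (hq.pos u h).le

lemma le_self (hq : IsProfile q) {u : ℝ} (hu : 0 ≤ u) : q u ≤ u := by
  rcases hu.eq_or_lt with rfl | h
  · exact hq.map_zero.le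
  · exact (hq.lt_self u h).le

lemma hasDerivAt (hq : IsProfile q) {u : ℝ} (hu : 0 < u) : ∃ d, HasDerivAt q d u ∧ |d| < 1 := by
  have hn : Set.Ici (0 : ℝ) ∈ nhds u := Ici_mem_nhds hu
  have h1 := hq.abs_deriv_lt u hu
  rw [derivWithin_of_mem_nhds hn] at h1
  exact ⟨_, (((hq.contDiffOn.differentiableOn (by norm_num)) u hu.le).differentiableAt
    hn).hasDerivAt, h1⟩

lemma strictMonoOn_add (hq : IsProfile q) : StrictMonoOn (fun u => q u + u) (Set.Ici 0) := by
  refine strictMonoOn_of_deriv_pos (convex_Ici 0)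
    (hq.contDiffOn.continuousOn.add continuousOn_id) fun u hu => ?_
  rw [interior_Ici] at hu
  obtain ⟨d, hd, h1⟩ := hq.hasDerivAt hu
  rw [(hd.fun_add (hasDerivAt_id' u)).deriv]
  linarith [(abs_lt.mp h1).1]

lemma strictMonoOn_sub (hq : IsProfile q) : StrictMonoOn (fun u => u - q u) (Set.Ici 0) := by
  refine strictMonoOn_of_deriv_pos (convex_Ici 0)
    (continuousOn_id.sub hq.contDiffOn.continuousOn) fun u hu => ?_
  rw [interior_Ici] at hu
  obtain ⟨d, hd, h1⟩ := hq.hasDerivAt hu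
  rw [((hasDerivAt_id' u).fun_sub hd).deriv]
  linarith [(abs_lt.mp h1).2]

/-- The parameter `u` removes the inverse function: properties of `Q` are read off the curve `((q u
+ u)/√2, (u - q u)/√2)`. -/
lemma transform_apply (hq : IsProfile q) {u : ℝ} (hu : 0 ≤ u) :
    transform q ((q u + u) / Real.sqrt 2) = (u - q u) / Real.sqrt 2 := by
  have h2 : Real.sqrt 2 ≠ 0 := by positivity
  have h : invAddId q (q u + u) = u := hq.bijOn.injOn.leftInvOn_invFunOn hu
  rw [transform, mul_div_cancel₀ _ h2, h]
  ring

lemma exists_param (hq : IsProfile q) {x : ℝ} (hx : 0 ≤ x) :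
    ∃ u, 0 ≤ u ∧ x = (q u + u) / Real.sqrt 2 := by
  obtain ⟨u, hu, h⟩ := hq.bijOn.surjOn (show Real.sqrt 2 * x ∈ Set.Ici 0 from
    mul_nonneg (Real.sqrt_nonneg 2) hx)
  refine ⟨u, hu, ?_⟩
  have h' : q u + u = Real.sqrt 2 * x := h
  rw [h', mul_div_cancel_left₀ _ (by positivity)]

lemma exists_le_mul (hq : IsProfile q) {ε : ℝ} (hε : 0 < ε) :
    ∃ δ, 0 < δ ∧ ∀ u, 0 ≤ u → u ≤ δ → q u ≤ ε * u := by
  have hd : HasDerivWithinAt q 0 (Set.Ici 0) 0 := by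
    have := ((hq.contDiffOn.differentiableOn (by norm_num)) 0 Set.self_mem_Ici).hasDerivWithinAt
    rwa [hq.deriv_zero] at this
  have h1 := (hasDerivWithinAt_iff_isLittleO.mp hd).def hε
  rw [eventually_nhdsWithin_iff, Metric.eventually_nhds_iff] at h1
  obtain ⟨δ, hδ, h1⟩ := h1
  refine ⟨δ / 2, by positivity, fun u hu hle => ?_⟩
  have h2 := h1 (y := u) (by rw [Real.dist_eq, sub_zero, abs_of_nonneg hu]; linarith) hu
  simp only [hq.map_zero, smul_zero, sub_zero, Real.norm_eq_abs, abs_of_nonneg hu] at h2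
  exact (le_abs_self _).trans h2

lemma slowMap (hq : IsProfile q) : SlowMap (transform q) := by
  have hs : 0 < Real.sqrt 2 := by positivity
  have hss : Real.sqrt 2 * Real.sqrt 2 = 2 := Real.mul_self_sqrt (by norm_num)
  have upos : ∀ u, 0 ≤ u → 0 < (q u + u) / Real.sqrt 2 → 0 < u := by
    intro u hu h
    refine lt_of_le_of_ne hu ?_
    rintro rfl
    simp [hq.map_zero] at h
  refine ⟨?_, ?_, ?_, ?_, ?_, ?_⟩
  · simpa [hq.map_zero] using hq.transform_apply le_rfl
  · intro x hx
    obtain ⟨u, hu, rfl⟩ := hq.exists_param hx.le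
    rw [hq.transform_apply hu]
    exact div_pos (sub_pos.mpr (hq.lt_self u (upos u hu hx))) hs
  · intro x hx
    obtain ⟨u, hu, rfl⟩ := hq.exists_param hx.le
    rw [hq.transform_apply hu]
    have := hq.pos u (upos u hu hx)
    gcongr
    linarith
  · intro x y hx hxy
    obtain ⟨u, hu, rfl⟩ := hq.exists_param hx
    obtain ⟨v, hv, rfl⟩ := hq.exists_param (hx.trans hxy)
    rw [hq.transform_apply hu, hq.transform_apply hv]
    have h1 : q u + u ≤ q v + v := (div_le_div_iff_of_pos_right hs).mp hxy
    have h2 : u ≤ v := (hq.strictMonoOn_add.le_iff_le hu hv).mp h1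
    have h3 : u - q u ≤ v - q v := hq.strictMonoOn_sub.monotoneOn hu hv h2
    gcongr
  · intro m M hm
    have hm2 : 0 < m / Real.sqrt 2 := by positivity
    have param : ∀ u, 0 ≤ u → m ≤ (q u + u) / Real.sqrt 2 → (q u + u) / Real.sqrt 2 ≤ M →
        u ∈ Set.Icc (m / Real.sqrt 2) (Real.sqrt 2 * M) := by
      intro u hu h1 h2
      rw [le_div_iff₀ hs] at h1
      rw [div_le_iff₀ hs] at h2
      have h3 := hq.nonneg hu
      have h4 := hq.le_self hu
      refine ⟨?_, by linarith⟩
      rw [div_le_iff₀ hs]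
      nlinarith
    rcases (Set.Icc (m / Real.sqrt 2) (Real.sqrt 2 * M)).eq_empty_or_nonempty with he | hne
    · refine ⟨1 / 2, by norm_num, by norm_num, fun x h1 h2 => ?_⟩
      obtain ⟨u, hu, rfl⟩ := hq.exists_param (hm.le.trans h1)
      have := param u hu h1 h2
      rw [he] at this
      exact this.elim
    · have hsub : Set.Icc (m / Real.sqrt 2) (Real.sqrt 2 * M) ⊆ Set.Ici 0 :=
        fun u hu => hm2.le.trans hu.1
      have hcq : ContinuousOn q (Set.Icc (m / Real.sqrt 2) (Real.sqrt 2 * M)) :=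
        hq.contDiffOn.continuousOn.mono hsub
      have hden : ∀ u ∈ Set.Icc (m / Real.sqrt 2) (Real.sqrt 2 * M), 0 < q u + u := fun u hu => by
        have := hq.nonneg (hsub hu)
        have := hm2.trans_le hu.1
        linarith
      -- The quotient `Q x / x` is `(u - q u) / (q u + u)`, whose maximum on the compact interval is
      -- below `1` because `q > 0` there.
      obtain ⟨w, hw, hmax⟩ := isCompact_Icc.exists_isMaxOn hne
        (show ContinuousOn (fun u => (u - q u) / (q u + u)) _ from
          (continuousOn_id.sub hcq).div (hcq.add continuousOn_id) fun u hu => (hden u hu).ne')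
      have hw0 : 0 < w := hm2.trans_le hw.1
      refine ⟨(w - q w) / (q w + w), div_pos (sub_pos.mpr (hq.lt_self w hw0)) (hden w hw), ?_,
        fun x h1 h2 => ?_⟩
      · rw [div_lt_one (hden w hw)]
        linarith [hq.pos w hw0]
      · obtain ⟨u, hu, rfl⟩ := hq.exists_param (hm.le.trans h1)
        have hu' := param u hu h1 h2
        have h3 : (u - q u) / (q u + u) ≤ (w - q w) / (q w + w) := hmax hu'
        rw [div_le_iff₀ (hden u hu')] at h3
        rw [hq.transform_apply hu, mul_div_assoc']
        gcongr
  · intro l hl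
    -- The goal amounts to `(1 + l) * q u ≤ (1 - l) * u`, and `1 + l < 2`.
    obtain ⟨δ, hδ, h⟩ := hq.exists_le_mul (show 0 < (1 - l) / 2 by linarith)
    refine ⟨δ / Real.sqrt 2, by positivity, fun x hx hxδ => ?_⟩
    obtain ⟨u, hu, rfl⟩ := hq.exists_param hx
    have h0 := hq.nonneg hu
    have h3 : u ≤ δ := by
      have := (div_le_div_iff_of_pos_right hs).mp hxδ
      linarith
    have h1 := h u hu h3
    have h2 := hq.le_self hu
    rw [hq.transform_apply hu, mul_div_assoc']
    gcongr
    rcases le_or_gt 0 l with h4 | h4 <;> nlinarith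

end IsProfile

/-- Points of the damping set, read in rotated coordinates, are steps of `transform q`. -/
lemma exists_isStep {S : Set (ℝ × ℝ)} {M : ℝ} {q : ℝ → ℝ}
    (hinf : SectorAtInfinity S M)
    (hdiag : S ∩ {w | w.1 = w.2} = {((0 : ℝ), (0 : ℝ))})
    (hq : IsProfile q) (hSq : ∀ w ∈ S ∩ ball M, |w.2| = q |w.1| ∨ |w.1| = q |w.2|) :
    ∃ l, 0 < l ∧ l < 1 ∧ ∀ w ∈ S,
      IsStep (transform q) (M / Real.sqrt 2) l |(rot w).1| |(rot w).2| := by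
  have hs : 0 < Real.sqrt 2 := by positivity
  obtain ⟨hsign, hM, a, b, ha, hb, hsec⟩ := hinf
  -- First coordinates below `M/√2` force `w` into the ball, while points of the ball have first
  -- coordinate at most `M` in absolute value; only `[M/√2, M]` needs the contraction of `Q`.
  obtain ⟨l, hl0, hl1, hl⟩ := hq.slowMap.contract (M / Real.sqrt 2) M (by positivity)
  have ha1 : 1 / (1 + a) < 1 := by rw [div_lt_one (by positivity)]; linarith
  have hb1 : b / (1 + b) < 1 := by rw [div_lt_one (by positivity)]; linarith
  refine ⟨max l (max (1 / (1 + a)) (b / (1 + b))), lt_max_of_lt_left hl0,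
    max_lt hl1 (max_lt ha1 hb1), fun w hw => ?_⟩
  set L := max l (max (1 / (1 + a)) (b / (1 + b))) with hL
  have hlL : l ≤ L := le_max_left _ _
  have haL : 1 / (1 + a) ≤ L := (le_max_left _ _).trans (le_max_right _ _)
  have hbL : b / (1 + b) ≤ L := (le_max_right _ _).trans (le_max_right _ _)
  rw [div_le_iff₀ (by positivity)] at haL hbL
  have hX : |(rot w).1| = (|w.1| + |w.2|) / Real.sqrt 2 := by
    rw [rot, ← add_div, abs_div, abs_of_pos hs, abs_add_eq_add_abs_iff w.1 w.2 |>.mpr]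
    rcases mul_nonneg_iff.mp (hsign w hw) with h | h
    · exact Or.inl h
    · exact Or.inr h
  have hY : |(rot w).2| = |(|w.2| - |w.1|)| / Real.sqrt 2 := by
    have h0 : (rot w).2 = (-w.1 + w.2) / Real.sqrt 2 := (add_div _ _ _).symm
    rw [h0, abs_div, abs_of_pos hs]
    congr 1
    rcases mul_nonneg_iff.mp (hsign w hw) with h | h
    · rw [abs_of_nonneg h.1, abs_of_nonneg h.2]; congr 1; ring
    · rw [abs_of_nonpos h.1, abs_of_nonpos h.2, ← abs_neg]; congr 1; ring
  have hx := abs_nonneg w.1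
  have hy := abs_nonneg w.2
  have hball : w ∈ ball M → |(rot w).2| = transform q |(rot w).1| := by
    intro hwb
    rw [hX, hY]
    rcases hSq w ⟨hw, hwb⟩ with h | h
    · rw [h, add_comm, hq.transform_apply hx, abs_sub_comm, abs_of_nonneg]
      linarith [hq.le_self hx]
    · rw [h, hq.transform_apply hy, abs_of_nonneg]
      linarith [hq.le_self hy]
  refine ⟨fun h => hball ?_, fun h => ?_, fun h => ?_⟩
  · rw [hX, div_lt_div_iff_of_pos_right hs] at h
    rw [ball, Set.mem_ofPred_eq, Real.sqrt_lt' hM, ← sq_abs w.1, ← sq_abs w.2]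
    nlinarith
  · by_cases hwb : w ∈ ball M
    · rw [hball hwb]
      refine (hl _ h ?_).trans (by gcongr)
      have h1 : Real.sqrt (w.1 ^ 2 + w.2 ^ 2) < M := hwb
      rw [Real.sqrt_lt' hM, ← sq_abs w.1, ← sq_abs w.2] at h1
      rw [hX, div_le_iff₀ hs]
      refine abs_le_of_sq_le_sq' ?_ (by positivity) |>.2
      rw [mul_pow, Real.sq_sqrt (by norm_num)]
      nlinarith [sq_nonneg (|w.1| - |w.2|)]
    -- Here `|x| - |y| ≤ |x| ≤ (|x| + |y|)/(1 + a)` and `|y| - |x| ≤ |y| ≤ b (|x| + |y|)/(1 + b)`.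
    · obtain ⟨h1, h2⟩ := hsec w ⟨hw, hwb⟩
      rw [hX, hY, mul_div_assoc']
      gcongr
      rw [abs_le]
      constructor <;> nlinarith
  · rw [hY, div_eq_zero_iff, or_iff_left hs.ne', abs_eq_zero, sub_eq_zero] at h
    have h1 : w.1 = w.2 := by
      rcases mul_nonneg_iff.mp (hsign w hw) with h2 | h2
      · rwa [abs_of_nonneg h2.1, abs_of_nonneg h2.2, eq_comm] at h
      · rw [abs_of_nonpos h2.1, abs_of_nonpos h2.2] at h; linarith
    have h2 : w ∈ S ∩ {w | w.1 = w.2} := ⟨hw, h1⟩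
    rw [hdiag, Set.mem_singleton_iff] at h2
    rw [hX, h2]
    simp

end BoundaryDamping

/-! ### Reduction of the wave to one profile, and its energy. -/

namespace BoundaryDamping

lemma MemLpLoc.locallyIntegrable_indicator {p : ℝ≥0∞} {a : ℝ} {f : ℝ → ℝ} (hp : 1 ≤ p)
    (hf : MemLpLoc p a f) : LocallyIntegrable ((Set.Ioi a).indicator f) := by
  rw [locallyIntegrable_iff]
  intro K hK
  obtain ⟨T, hT⟩ := hK.bddAbove
  have h1 : IntegrableOn f (Set.Ioo a (T + 1)) := (hf (T + 1)).integrable hp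
  have h2 := h1.integrable_indicator measurableSet_Ioo
  refine h2.integrableOn.congr_fun_ae (s := K) ?_
  refine (ae_restrict_iff' hK.measurableSet).mpr (Filter.Eventually.of_forall fun x hx => ?_)
  have : x < T + 1 := (hT hx).trans_lt (lt_add_one T)
  by_cases hxa : a < x
  · rw [Set.indicator_of_mem (show x ∈ Set.Ioo a (T + 1) from ⟨hxa, this⟩),
      Set.indicator_of_mem (show x ∈ Set.Ioi a from hxa)]
  · rw [Set.indicator_of_notMem fun h : x ∈ Set.Ioo a (T + 1) => hxa h.1,
      Set.indicator_of_notMem fun h : x ∈ Set.Ioi a => hxa h]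

lemma integral_indicator_Ioi {a y : ℝ} (ha : a ≤ 0) (hy : a ≤ y) (f : ℝ → ℝ) :
    ∫ s in (0 : ℝ)..y, (Set.Ioi a).indicator f s = ∫ s in (0 : ℝ)..y, f s := by
  refine intervalIntegral.integral_congr_ae (Filter.Eventually.of_forall fun s hs => ?_)
  refine Set.indicator_of_mem ?_ f
  rw [Set.mem_uIoc] at hs
  rcases hs with h | h
  · exact ha.trans_lt h.1
  · exact hy.trans_lt h.1

/-- The wave in terms of its reflected profile `g` alone: `g` is the trace of the solution along
the incoming characteristics, and `(g (t - 1), g (t + 1))` lies in the rotated damping set. -/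
structure IsProfileOf (p : ℝ≥0∞) (S : Set (ℝ × ℝ)) (z : ℝ → ℝ → ℝ) (g : ℝ → ℝ) : Prop where
  locallyIntegrable : LocallyIntegrable g
  memLp : ∀ T, MemLp g p (volume.restrict (Set.Ioo (-1) T))
  eq : ∀ t : ℝ, 0 ≤ t → ∀ x ∈ Set.Icc (0 : ℝ) 1,
    z t x = 1 / Real.sqrt 2 * ((∫ s in (0 : ℝ)..(t - x), g s) - ∫ s in (0 : ℝ)..(t + x), g s)
  reflect : ∀ᵐ t : ℝ, 0 < t → (g (t - 1), g (t + 1)) ∈ rot '' S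

lemma ae_sub_const {P : ℝ → Prop} (h : ∀ᵐ s : ℝ, P s) (c : ℝ) : ∀ᵐ t : ℝ, P (t - c) :=
  (measurePreserving_sub_right volume c).quasiMeasurePreserving.ae h

lemma ae_add_const {P : ℝ → Prop} (h : ∀ᵐ s : ℝ, P s) (c : ℝ) : ∀ᵐ t : ℝ, P (t + c) :=
  (measurePreserving_add_right volume c).quasiMeasurePreserving.ae h

lemma ae_const_sub {P : ℝ → Prop} (h : ∀ᵐ s : ℝ, P s) (c : ℝ) : ∀ᵐ t : ℝ, P (c - t) :=
  (Measure.measurePreserving_sub_left volume c).quasiMeasurePreserving.ae h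

lemma ae_const_add {P : ℝ → Prop} (h : ∀ᵐ s : ℝ, P s) (c : ℝ) : ∀ᵐ t : ℝ, P (c + t) :=
  (measurePreserving_add_left volume c).quasiMeasurePreserving.ae h

lemma hasDerivAt_wave_time {G : ℝ → ℝ} {t x u v : ℝ} (hu : HasDerivAt G u (t - x))
    (hv : HasDerivAt G v (t + x)) :
    HasDerivAt (fun s => 1 / Real.sqrt 2 * (G (s - x) - G (s + x)))
      (1 / Real.sqrt 2 * (u - v)) t :=
  ((hu.comp_sub_const t x).fun_sub (hv.comp_add_const t x)).const_mul _

lemma hasDerivAt_wave_space {G : ℝ → ℝ} {t x u v : ℝ} (hu : HasDerivAt G u (t - x))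
    (hv : HasDerivAt G v (t + x)) :
    HasDerivAt (fun y => 1 / Real.sqrt 2 * (G (t - y) - G (t + y)))
      (1 / Real.sqrt 2 * (-u - v)) x :=
  ((hu.comp_const_sub t x).fun_sub (hv.comp_const_add t x)).const_mul _

lemma IsWeakSolution.exists_profile {p : ℝ≥0∞} {S : Set (ℝ × ℝ)} {z₀ z₁ : ℝ → ℝ}
    {z : ℝ → ℝ → ℝ} (hp : 1 ≤ p) (hz : IsWeakSolution p S z₀ z₁ z) :
    ∃ g, IsProfileOf p S z g := by
  obtain ⟨-, f, g₀, hf, hg, hform, hzero, hbd, -, -⟩ := hz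
  have hfi := hf.locallyIntegrable_indicator hp
  have hgi := hg.locallyIntegrable_indicator hp
  -- Extension by zero makes the profiles locally integrable on all of `ℝ`, for Lebesgue
  -- differentiation and translations; no value of `z` changes.
  set g := (Set.Ioi (-1 : ℝ)).indicator g₀ with hgdef
  set f' := (Set.Ioi (0 : ℝ)).indicator f with hfdef
  have hs : 0 < Real.sqrt 2 := by positivity
  have hform' : ∀ t : ℝ, 0 ≤ t → ∀ x ∈ Set.Icc (0 : ℝ) 1,
      z t x = (1 / Real.sqrt 2) * (∫ s in (0 : ℝ)..(t + x), f' s) +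
        (1 / Real.sqrt 2) * ∫ s in (0 : ℝ)..(t - x), g s := by
    intro t ht x hx
    rw [hform t ht x hx, hfdef, hgdef,
      integral_indicator_Ioi le_rfl (by linarith [hx.1]),
      integral_indicator_Ioi (by norm_num) (by linarith [hx.2])]
  have hcont : ∀ {h : ℝ → ℝ}, LocallyIntegrable h → Continuous fun y => ∫ s in (0 : ℝ)..y, h s :=
    fun hh => intervalIntegral.continuous_primitive
      (fun a b => hh.integrableOn_isCompact isCompact_uIcc |>.intervalIntegrable) 0
  have hFG : ∀ t : ℝ, 0 ≤ t → ∫ s in (0 : ℝ)..t, f' s = -∫ s in (0 : ℝ)..t, g s := by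
    have hae : (fun t => ∫ s in (0 : ℝ)..t, f' s) =ᵐ[volume.restrict (Set.Ici (0 : ℝ))]
        fun t => -∫ s in (0 : ℝ)..t, g s := by
      filter_upwards [hzero, self_mem_ae_restrict measurableSet_Ici] with t ht ht0
      rw [hform' t ht0 0 (by norm_num), add_zero, sub_zero, ← mul_add, mul_eq_zero] at ht
      have := ht.resolve_left (by positivity)
      linarith
    -- Both primitives are continuous, so the almost everywhere identity holds at every `t ≥ 0`.
    have := Measure.eqOn_of_ae_eq hae (hcont hfi).continuousOn (hcont hgi).neg.continuousOn
      (by rw [interior_Ici, closure_Ioi])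
    exact fun t ht => this ht
  have heq : ∀ t : ℝ, 0 ≤ t → ∀ x ∈ Set.Icc (0 : ℝ) 1, z t x = 1 / Real.sqrt 2 *
      ((∫ s in (0 : ℝ)..(t - x), g s) - ∫ s in (0 : ℝ)..(t + x), g s) := by
    intro t ht x hx
    rw [hform' t ht x hx, hFG (t + x) (by linarith [hx.1])]
    ring
  refine ⟨g, hgi, fun T => (memLp_congr_ae ?_).mpr (hg T), heq, ?_⟩
  · refine (ae_restrict_iff' measurableSet_Ioo).mpr (Filter.Eventually.of_forall fun x hx => ?_)
    exact Set.indicator_of_mem (show x ∈ Set.Ioi (-1 : ℝ) from hx.1) g₀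
  · have hLD := _root_.LocallyIntegrable.ae_hasDerivAt_integral hgi
    rw [ae_restrict_iff' measurableSet_Ici] at hbd
    filter_upwards [hbd, ae_sub_const hLD 1, ae_add_const hLD 1] with t hbt h1 h2 ht
    obtain ⟨a, b, ha, hb, hab⟩ := hbt ht.le
    have h3 := (hasDerivAt_wave_time (h1 0) (h2 0)).hasDerivWithinAt (s := Set.Ici 0)
    have h4 := (hasDerivAt_wave_space (h1 0) (h2 0)).hasDerivWithinAt (s := Set.Icc 0 1)
    have h5 := h3.congr (f₁ := fun s => z s 1) (fun s hs => heq s hs 1 (by norm_num))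
      (heq t ht.le 1 (by norm_num))
    have h6 := h4.congr (f₁ := fun x => z t x) (fun x hx => heq t ht.le x hx)
      (heq t ht.le 1 (by norm_num))
    have ea := (uniqueDiffOn_Ici (0 : ℝ) t ht.le).eq_deriv _ ha h5
    have eb := (uniqueDiffOn_Icc (zero_lt_one' ℝ) 1 (by norm_num)).eq_deriv _ hb h6
    refine ⟨_, hab, ?_⟩
    have hss : Real.sqrt 2 ^ 2 = 2 := Real.sq_sqrt (by norm_num)
    rw [ea, eb, rot]
    ext
    · simp only
      field_simp
      rw [hss]
      ring
    · simp only
      field_simp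
      rw [hss]
      ring

/-- The window `(t - 1, t + 1)` is the union of the images of `(0, 1)` under `x ↦ t + x` and
`x ↦ t - x`, up to a null set. -/
lemma restrict_window (t : ℝ) : volume.restrict (Set.Ioo (t - 1) (t + 1)) =
    (volume.restrict (Set.Ioo (0 : ℝ) 1)).map (fun x => t + x) +
      (volume.restrict (Set.Ioo (0 : ℝ) 1)).map (fun x => t - x) := by
  have e1 : MeasurableEmbedding fun x : ℝ => t + x := measurableEmbedding_addLeft t
  have e2 : MeasurableEmbedding fun x : ℝ => t - x := measurableEmbedding_subLeft t
  have h1 : (volume.restrict (Set.Ioo (0 : ℝ) 1)).map (fun x => t + x) =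
      volume.restrict (Set.Ioo t (t + 1)) := by
    have := e1.restrict_map volume (Set.Ioo t (t + 1))
    rw [(measurePreserving_add_left volume t).map_eq] at this
    rw [this]
    congr 2
    ext x; simp
  have h2 : (volume.restrict (Set.Ioo (0 : ℝ) 1)).map (fun x => t - x) =
      volume.restrict (Set.Ioo (t - 1) t) := by
    have := e2.restrict_map volume (Set.Ioo (t - 1) t)
    rw [(Measure.measurePreserving_sub_left volume t).map_eq] at this
    rw [this]
    congr 2
    ext x
    simp only [Set.mem_Ioo, Set.mem_preimage]
    constructor <;> rintro ⟨_, _⟩ <;> constructor <;> linarith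
  have h3 : Set.Ioc (t - 1) t ∪ Set.Ioo t (t + 1) = Set.Ioo (t - 1) (t + 1) :=
    Set.Ioc_union_Ioo_eq_Ioo (by linarith) (by linarith)
  rw [h1, h2, ← h3, Measure.restrict_union (Set.disjoint_left.mpr fun x hx hx' =>
    (hx.2.trans_lt hx'.1).false) measurableSet_Ioo, add_comm,
    Measure.restrict_congr_set (Ioo_ae_eq_Ioc (μ := volume) (a := t - 1) (b := t))]

lemma IsProfileOf.energy_eq {p : ℝ≥0∞} {S : Set (ℝ × ℝ)} {z : ℝ → ℝ → ℝ} {g : ℝ → ℝ}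
    (hp : 1 ≤ p) (hg : IsProfileOf p S z g) {t : ℝ} (ht : 0 ≤ t) :
    energy p z t = eLpNorm g p (volume.restrict (Set.Ioo (t - 1) (t + 1))) := by
  have hs : 0 < Real.sqrt 2 := by positivity
  have hss : Real.sqrt 2 ^ 2 = 2 := Real.sq_sqrt (by norm_num)
  have e1 : MeasurableEmbedding fun x : ℝ => t + x := measurableEmbedding_addLeft t
  have e2 : MeasurableEmbedding fun x : ℝ => t - x := measurableEmbedding_subLeft t
  have hLD := _root_.LocallyIntegrable.ae_hasDerivAt_integral hg.locallyIntegrable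
  have hder : ∀ᵐ x ∂(volume.restrict (Set.Ioo (0 : ℝ) 1)),
      ‖deriv (z t) x + timeDeriv z t x‖ₑ = ENNReal.ofReal (Real.sqrt 2) * ‖g (t + x)‖ₑ ∧
      ‖deriv (z t) x - timeDeriv z t x‖ₑ = ENNReal.ofReal (Real.sqrt 2) * ‖g (t - x)‖ₑ := by
    rw [ae_restrict_iff' measurableSet_Ioo]
    filter_upwards [ae_const_sub hLD t, ae_const_add hLD t] with x h1 h2 hx
    have h3 := (hasDerivAt_wave_time (h1 0) (h2 0)).hasDerivWithinAt (s := Set.Ici 0)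
    have h4 := hasDerivAt_wave_space (h1 0) (h2 0)
    have hx' := Set.Ioo_subset_Icc_self hx
    have h5 : timeDeriv z t x = _ := (h3.congr (f₁ := fun s => z s x)
      (fun s hs => hg.eq s hs x hx') (hg.eq t ht x hx')).derivWithin (uniqueDiffOn_Ici 0 t ht)
    have h6 : deriv (z t) x = _ := (h4.congr_of_eventuallyEq (f₁ := z t)
      (by filter_upwards [Ioo_mem_nhds hx.1 hx.2] with y hy using
        hg.eq t ht y (Set.Ioo_subset_Icc_self hy))).deriv
    rw [h5, h6, ← Real.enorm_of_nonneg hs.le, ← enorm_mul, ← enorm_mul,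
      ← enorm_neg (Real.sqrt 2 * g (t + x)), ← enorm_neg (Real.sqrt 2 * g (t - x))]
    constructor <;> congr 1 <;> field_simp <;> rw [hss] <;> ring
  have hmeas : AEStronglyMeasurable g := hg.locallyIntegrable.aestronglyMeasurable
  rw [energy, normX]
  split_ifs with hpt
  · rw [hpt, eLpNorm_exponent_top, eLpNormEssSup, restrict_window,
      essSup_congr_ae (hder.mono fun x hx => hx.1), essSup_congr_ae (hder.mono fun x hx => hx.2),
      ENNReal.essSup_const_mul, ENNReal.essSup_const_mul, ← mul_max, ← mul_assoc,
      ← ENNReal.ofReal_mul (by positivity), one_div_mul_cancel hs.ne', ENNReal.ofReal_one, one_mul]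
    have hae : ∀ μ ν : Measure ℝ, ae (μ + ν) = ae μ ⊔ ae ν := fun μ ν => by
      ext s; exact ae_add_measure_iff
    conv_rhs => rw [essSup, hae, Filter.limsup_sup_filter]
    congr 1
    · exact (e1.essSup_map_measure (g := fun x => ‖g x‖ₑ)).symm
    · exact (e2.essSup_map_measure (g := fun x => ‖g x‖ₑ)).symm
  · have hp0 : p ≠ 0 := (zero_lt_one.trans_le hp).ne'
    have hpr : 0 < p.toReal := ENNReal.toReal_pos hp0 hpt
    rw [eLpNorm_eq_lintegral_rpow_enorm_toReal hp0 hpt, restrict_window, lintegral_add_measure,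
      e1.lintegral_map, e2.lintegral_map]
    congr 1
    -- The weight `2^(-p/2)` in the norm exactly cancels the factor `√2` of the derivatives.
    have hc : ENNReal.ofReal (1 / (2 : ℝ) ^ (p.toReal / 2)) *
        ENNReal.ofReal (Real.sqrt 2) ^ p.toReal = 1 := by
      rw [ENNReal.ofReal_rpow_of_nonneg hs.le hpr.le, ← ENNReal.ofReal_mul (by positivity),
        Real.sqrt_eq_rpow, ← Real.rpow_mul (by norm_num), one_div_mul_eq_div (2 : ℝ),
        one_div_mul_cancel (by positivity), ENNReal.ofReal_one]
    have m1 : AEMeasurable (fun x => ‖g (t + x)‖ₑ ^ p.toReal)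
        (volume.restrict (Set.Ioo (0 : ℝ) 1)) :=
      ((hmeas.comp_measurePreserving (measurePreserving_add_left volume t)).enorm.pow_const
        p.toReal).restrict
    rw [lintegral_congr_ae (hder.mono fun x hx => show _ = ENNReal.ofReal (Real.sqrt 2) ^ p.toReal *
        (‖g (t + x)‖ₑ ^ p.toReal + ‖g (t - x)‖ₑ ^ p.toReal) by
      rw [hx.1, hx.2, ENNReal.mul_rpow_of_nonneg _ _ hpr.le, ENNReal.mul_rpow_of_nonneg _ _ hpr.le,
        mul_add]), lintegral_const_mul' _ _ (by finiteness), ← mul_assoc, hc, one_mul,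
      lintegral_add_left' m1]

end BoundaryDamping

/-! ### Energy bounds from pointwise orbits. -/

namespace BoundaryDamping

variable {p : ℝ≥0∞} {S : Set (ℝ × ℝ)} {z : ℝ → ℝ → ℝ} {g T : ℝ → ℝ} {m l : ℝ}

lemma IsProfileOf.ae_isStep (hg : IsProfileOf p S z g)
    (hS : ∀ w ∈ S, IsStep T m l |(rot w).1| |(rot w).2|) :
    ∀ᵐ s : ℝ, -1 < s → ∀ n : ℕ,
      IsStep T m l |g (s + 2 * n)| |g (s + 2 * (n + 1 : ℕ))| := by
  have h1 : ∀ᵐ s : ℝ, ∀ n : ℕ, 0 < s + (2 * n + 1) →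
      (g (s + (2 * n + 1) - 1), g (s + (2 * n + 1) + 1)) ∈ rot '' S :=
    ae_all_iff.mpr fun n => ae_add_const hg.reflect _
  filter_upwards [h1] with s hs h n
  obtain ⟨w, hw, hw'⟩ := hs n (by have : (0 : ℝ) ≤ n := n.cast_nonneg; linarith)
  have h2 := hS w hw
  rw [hw'] at h2
  convert h2 using 3 <;> push_cast <;> ring

/-- Zero is fixed by `T` and lies below the threshold `m`, so vanishing on `(-1, 1)` would propagate
by steps of `2` to the whole profile. -/
lemma IsProfileOf.exists_ne_zero (hg : IsProfileOf p S z g)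
    (hS : ∀ w ∈ S, IsStep T m l |(rot w).1| |(rot w).2|) (hz : Nontrivial z)
    (hT : T 0 = 0) (hm : 0 < m) :
    ¬ ∀ᵐ s : ℝ, s ∈ Set.Ioo (-1 : ℝ) 1 → g s = 0 := by
  intro h0
  obtain ⟨t, ht, x, hx, hne⟩ := hz
  have h1 : ∀ᵐ s : ℝ, ∀ n : ℕ, s - 2 * n ∈ Set.Ioo (-1 : ℝ) 1 → g (s - 2 * n) = 0 :=
    ae_all_iff.mpr fun n => ae_sub_const h0 _
  have h2 : ∀ᵐ s : ℝ, ∀ n : ℕ, -1 < s - 2 * n → ∀ k : ℕ,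
      IsStep T m l |g (s - 2 * n + 2 * k)| |g (s - 2 * n + 2 * (k + 1 : ℕ))| :=
    ae_all_iff.mpr fun n => ae_sub_const (hg.ae_isStep hS) _
  -- The floor only places `s - 2 * n` in `[-1, 1)`; the left endpoints are discarded.
  have h3 : ∀ᵐ s : ℝ, ∀ n : ℕ, s ≠ 2 * n - 1 :=
    ae_all_iff.mpr fun n => Measure.ae_ne volume _
  have h4 : ∀ᵐ s : ℝ, -1 < s → g s = 0 := by
    filter_upwards [h1, h2, h3] with s hs1 hs2 hs3 hs
    set n := ⌊(s + 1) / 2⌋₊ with hn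
    have ha : (n : ℝ) ≤ (s + 1) / 2 := Nat.floor_le (by linarith)
    have hb : (s + 1) / 2 < n + 1 := Nat.lt_floor_add_one _
    have hc : -1 < s - 2 * n := by
      refine lt_of_le_of_ne (by linarith) fun h => hs3 n (by linarith)
    have key : ∀ k : ℕ, g (s - 2 * n + 2 * k) = 0 := by
      intro k
      induction k with
      | zero => simpa using hs1 n ⟨hc, by linarith⟩
      | succ k ih =>
        have := (hs2 n hc k).1 (by rw [ih, abs_zero]; exact hm)
        rw [ih, abs_zero, hT] at this
        exact abs_eq_zero.mp this
    simpa using key n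
  have hint : ∀ y : ℝ, -1 ≤ y → ∫ s in (0 : ℝ)..y, g s = 0 := by
    intro y hy
    rw [intervalIntegral.integral_congr_ae (g := fun _ => (0 : ℝ)), intervalIntegral.integral_zero]
    filter_upwards [h4] with s hs hsy
    refine hs ?_
    rw [Set.mem_uIoc] at hsy
    rcases hsy with h | h
    · linarith [h.1]
    · linarith [h.1]
  apply hne
  rw [hg.eq t ht x hx, hint _ (by linarith [hx.2]), hint _ (by linarith [hx.1])]
  simp

lemma window_index {t : ℝ} (ht : 0 ≤ t) :
    2 * (⌊t / 2⌋₊ : ℝ) ≤ t ∧ t < 2 * (⌊t / 2⌋₊ : ℝ) + 2 := by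
  have ha : (⌊t / 2⌋₊ : ℝ) ≤ t / 2 := Nat.floor_le (by linarith)
  have hb : t / 2 < ⌊t / 2⌋₊ + 1 := Nat.lt_floor_add_one _
  constructor <;> linarith

lemma measurePreserving_add_window (n : ℕ) :
    MeasurePreserving (fun s : ℝ => s + 2 * n) (volume.restrict (Set.Ioo (-1 : ℝ) 3))
      (volume.restrict (Set.Ioo (2 * n - 1 : ℝ) (2 * n + 3))) := by
  have h1 := (measurePreserving_add_right volume (2 * n : ℝ)).restrict_preimage
    (measurableSet_Ioo (a := (2 * n - 1 : ℝ)) (b := 2 * n + 3))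
  have h2 : (fun s : ℝ => s + 2 * n) ⁻¹' Set.Ioo (2 * n - 1 : ℝ) (2 * n + 3) =
      Set.Ioo (-1 : ℝ) 3 := by
    ext x
    simp only [Set.mem_Ioo, Set.mem_preimage]
    constructor <;> rintro ⟨_, _⟩ <;> constructor <;> linarith
  rwa [h2] at h1

lemma IsProfileOf.energy_le (hp : 1 ≤ p) (hg : IsProfileOf p S z g) (hT : SlowMap T)
    (hm : 0 < m) (hl0 : 0 < l) (hl1 : l < 1)
    (hS : ∀ w ∈ S, IsStep T m l |(rot w).1| |(rot w).2|) :
    ∃ C, 0 < C ∧ ∀ t : ℝ, 0 ≤ t →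
      energy p z t ≤ ENNReal.ofReal (C * T^[⌊t / 2⌋₊] 1) := by
  obtain ⟨C, hC, horb⟩ := hT.orbit_le hm hl0 hl1
  -- The window `(t - 1, t + 1)` lies in `(2n - 1, 2n + 3)`, so translating by `2n` starts all
  -- orbits in `(-1, 3)`.
  have hmem : MemLp (fun s => 1 + |g s|) p (volume.restrict (Set.Ioo (-1 : ℝ) 3)) :=
    MemLp.add (f := fun _ => (1 : ℝ)) (g := fun s => ‖g s‖) (memLp_const 1) (hg.memLp 3).norm
  have hDtop := hmem.eLpNorm_ne_top
  generalize hD : eLpNorm (fun s => 1 + |g s|) p (volume.restrict (Set.Ioo (-1 : ℝ) 3)) = D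
    at hDtop
  refine ⟨C * (D.toReal + 1), by positivity, fun t ht => ?_⟩
  obtain ⟨hn1, hn2⟩ := window_index ht
  set n := ⌊t / 2⌋₊
  have hTn := (hT.iterate_pos one_pos n).le
  rw [hg.energy_eq hp ht]
  have hmp := measurePreserving_add_window n
  have hpt : ∀ᵐ s ∂(volume.restrict (Set.Ioo (-1 : ℝ) 3)), ‖(g ∘ fun s : ℝ => s + 2 * n) s‖ ≤
      C * T^[n] 1 * ‖1 + |g s|‖ := by
    rw [ae_restrict_iff' measurableSet_Ioo]
    filter_upwards [hg.ae_isStep hS] with s hs hs1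
    have h1 := horb (fun k => |g (s + 2 * k)|) (fun k => abs_nonneg _) (hs hs1.1) n
    rw [Real.norm_eq_abs, Real.norm_of_nonneg (by positivity)]
    simp only [Nat.cast_zero, mul_zero, add_zero] at h1
    rw [Function.comp_apply]
    linarith
  calc eLpNorm g p (volume.restrict (Set.Ioo (t - 1) (t + 1)))
      ≤ eLpNorm g p (volume.restrict (Set.Ioo (2 * n - 1 : ℝ) (2 * n + 3))) :=
        eLpNorm_mono_measure g (Measure.restrict_mono
          (Set.Ioo_subset_Ioo (by linarith) (by linarith)) le_rfl)
    _ = eLpNorm (g ∘ fun s : ℝ => s + 2 * n) p (volume.restrict (Set.Ioo (-1 : ℝ) 3)) :=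
        (eLpNorm_comp_measurePreserving hg.locallyIntegrable.aestronglyMeasurable.restrict
          hmp).symm
    _ ≤ ENNReal.ofReal (C * T^[n] 1) * D := by
        rw [← hD]; exact eLpNorm_le_mul_eLpNorm_of_ae_le_mul hpt p
    _ ≤ ENNReal.ofReal (C * T^[n] 1) * ENNReal.ofReal (D.toReal + 1) := by
        gcongr
        exact (ENNReal.le_ofReal_iff_toReal_le hDtop (by positivity)).mpr (by linarith)
    _ = ENNReal.ofReal (C * (D.toReal + 1) * T^[n] 1) := by
        rw [← ENNReal.ofReal_mul (by positivity)]
        congr 1; ring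

/-- On a set of positive measure of initial points, all reflections stay above a fixed multiple
of the iterates of `T`. -/
lemma IsProfileOf.exists_lower_set (hg : IsProfileOf p S z g) (hT : SlowMap T)
    (hm : 0 < m) (hl0 : 0 < l) (hl1 : l < 1)
    (hS : ∀ w ∈ S, IsStep T m l |(rot w).1| |(rot w).2|) (hz : Nontrivial z) :
    ∃ c, 0 < c ∧ volume {s ∈ Set.Ioo (-1 : ℝ) 1 | ∀ n : ℕ, c * T^[n] 1 ≤ |g (s + 2 * n)|} ≠ 0 := by
  by_contra! hcon
  refine hg.exists_ne_zero hS hz hT.map_zero hm ?_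
  -- Were all these sets null, so would be their countable union over `c = 1/(N + 1)`, which
  -- contains almost every `s` in `(-1, 1)` with `g s ≠ 0`.
  have h1 : ∀ᵐ s : ℝ, ∀ N : ℕ, s ∉ {s ∈ Set.Ioo (-1 : ℝ) 1 |
      ∀ n : ℕ, 1 / ((N : ℝ) + 1) * T^[n] 1 ≤ |g (s + 2 * n)|} :=
    ae_all_iff.mpr fun N => measure_eq_zero_iff_ae_notMem.mp (hcon _ (by positivity))
  filter_upwards [h1, hg.ae_isStep hS] with s hs1 hs2 hs
  by_contra hne
  obtain ⟨c, hc, h⟩ := hT.le_orbit hl0 hl1 hm (X := fun k => |g (s + 2 * k)|)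
    (fun k => abs_nonneg _) (hs2 hs.1) (by simpa using hne)
  obtain ⟨N, hN⟩ := exists_nat_one_div_lt hc
  refine hs1 N ⟨hs, fun n => le_trans ?_ (h n)⟩
  have := hT.iterate_pos one_pos n
  gcongr

lemma ofReal_mul_rpow_le_eLpNorm {μ : Measure ℝ} (hp : p ≠ 0) {a : ℝ} (ha : 0 ≤ a)
    {E : Set ℝ} (hE : NullMeasurableSet E μ) (hE0 : μ E ≠ 0) (h : ∀ s ∈ E, a ≤ |g s|) :
    ENNReal.ofReal a * μ E ^ (1 / p.toReal) ≤ eLpNorm g p μ := by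
  have h1 : eLpNorm (fun _ => a) p (μ.restrict E) = ENNReal.ofReal a * μ E ^ (1 / p.toReal) := by
    rw [eLpNorm_const a hp (by rwa [Ne, Measure.restrict_eq_zero]), Measure.restrict_apply_univ,
      Real.enorm_of_nonneg ha]
  rw [← h1]
  refine le_trans (eLpNorm_mono_ae ?_) (eLpNorm_mono_measure g Measure.restrict_le_self)
  rw [ae_restrict_iff'₀ hE]
  refine Filter.Eventually.of_forall fun s hs => ?_
  rw [Real.norm_of_nonneg ha]
  exact h s hs

lemma IsProfileOf.le_energy (hp : 1 ≤ p) (hg : IsProfileOf p S z g) (hT : SlowMap T)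
    (hm : 0 < m) (hl0 : 0 < l) (hl1 : l < 1)
    (hS : ∀ w ∈ S, IsStep T m l |(rot w).1| |(rot w).2|) (hz : Nontrivial z) :
    ∃ C, 0 < C ∧ ∀ t : ℝ, 0 ≤ t →
      ENNReal.ofReal (C * T^[⌊t / 2⌋₊] 1) ≤ energy p z t := by
  obtain ⟨c, hc, hA0⟩ := hg.exists_lower_set hT hm hl0 hl1 hS hz
  set A := {s ∈ Set.Ioo (-1 : ℝ) 1 | ∀ n : ℕ, c * T^[n] 1 ≤ |g (s + 2 * n)|} with hA
  have hmeas : AEStronglyMeasurable g := hg.locallyIntegrable.aestronglyMeasurable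
  have hAm : NullMeasurableSet A := by
    have : A = Set.Ioo (-1 : ℝ) 1 ∩ ⋂ n : ℕ, {s | c * T^[n] 1 ≤ |g (s + 2 * n)|} := by
      ext s; simp [hA]
    rw [this]
    refine measurableSet_Ioo.nullMeasurableSet.inter (NullMeasurableSet.iInter fun n => ?_)
    refine nullMeasurableSet_le aemeasurable_const ?_
    have := (hmeas.comp_measurePreserving
      (measurePreserving_add_right volume (2 * n : ℝ))).aemeasurable
    exact this.norm
  have hAtop : volume A ≠ ∞ :=
    measure_ne_top_of_subset (fun s hs => hs.1) (measure_Ioo_lt_top (a := (-1 : ℝ)) (b := 1)).ne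
  have hp0 : p ≠ 0 := (zero_lt_one.trans_le hp).ne'
  obtain ⟨d, hd, hratio⟩ := hT.iterate_add_ge one_pos (l := 1 / 2) (by norm_num) (by norm_num)
  -- For `p = ∞` the exponent is `1 / 0 = 0`, so `e = 1` and the same argument covers the supremum
  -- norm.
  set e := (volume A / 2) ^ (1 / p.toReal) with he
  have hA2 : volume A / 2 ≠ 0 := (ENNReal.half_pos hA0).ne'
  have hA2' : volume A / 2 ≠ ∞ := (ENNReal.div_lt_top hAtop (by norm_num)).ne
  have he0 : e ≠ 0 := (ENNReal.rpow_pos (pos_iff_ne_zero.mpr hA2) hA2').ne'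
  have hetop : e ≠ ∞ := ENNReal.rpow_ne_top_of_nonneg (by positivity) hA2'
  have her : 0 < e.toReal := ENNReal.toReal_pos he0 hetop
  refine ⟨c * (d * (1 / 2)) * e.toReal, by positivity, fun t ht => ?_⟩
  obtain ⟨hn1, hn2⟩ := window_index ht
  set n := ⌊t / 2⌋₊
  have hTn := hT.iterate_pos one_pos (n + 1)
  have hTle : d * (1 / 2) * T^[n] 1 ≤ T^[n + 1] 1 := by simpa using hratio n 1
  rw [hg.energy_eq hp ht]
  set W := Set.Ioo (t - 1) (t + 1) with hW
  -- Cut at `t - 2n - 1`, the right part of `A` enters the window after translation by `2n`, the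
  -- left part by `2n + 2`, and one of them has at least half the measure. The factor `d * (1 / 2)`
  -- pays for the possible extra step.
  have main : ∀ (k : ℕ) (B : Set ℝ), n ≤ k → k ≤ n + 1 → NullMeasurableSet B → B ⊆ A →
      (∀ s ∈ B, s + 2 * k ∈ W) → volume A / 2 ≤ volume B →
      ENNReal.ofReal (c * (d * (1 / 2)) * e.toReal * T^[n] 1) ≤
        eLpNorm g p (volume.restrict W) := by
    intro k B hk1 hk2 hBm hBA hBW hBv
    set E := (fun s : ℝ => s - 2 * k) ⁻¹' B with hE
    have hmp := measurePreserving_sub_right volume (2 * k : ℝ)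
    have hEm : NullMeasurableSet E := hBm.preimage hmp.quasiMeasurePreserving
    have hEW : E ⊆ W := fun s hs => by simpa using hBW _ hs
    have hEv : volume E = volume B := hmp.measure_preimage hBm
    have hEv' : volume.restrict W E = volume B := by
      rw [Measure.restrict_eq_self _ hEW, hEv]
    have hB0 : volume B ≠ 0 := ((ENNReal.half_pos hA0).trans_le hBv).ne'
    have h1 := ofReal_mul_rpow_le_eLpNorm (g := g) (μ := volume.restrict W) hp0
      (a := c * T^[n + 1] 1) (by positivity) (hEm.mono_ac Measure.restrict_le_self.absolutelyContinuous)
      (by rwa [hEv']) (fun s hs => by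
        have h2 := (hBA hs).2 k
        rw [sub_add_cancel] at h2
        refine le_trans ?_ h2
        have := hT.iterate_antitone zero_le_one hk2
        gcongr)
    refine le_trans ?_ h1
    rw [hEv']
    calc ENNReal.ofReal (c * (d * (1 / 2)) * e.toReal * T^[n] 1)
        = ENNReal.ofReal (c * (d * (1 / 2) * T^[n] 1)) * e := by
          rw [← ENNReal.ofReal_toReal hetop, ← ENNReal.ofReal_mul' ENNReal.toReal_nonneg,
            ENNReal.toReal_ofReal ENNReal.toReal_nonneg]
          congr 1; ring
      _ ≤ ENNReal.ofReal (c * T^[n + 1] 1) * volume B ^ (1 / p.toReal) := by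
          rw [he]; gcongr
  have hsplit : volume A ≤ volume (A ∩ Set.Ioi (t - 2 * n - 1)) +
      volume (A ∩ Set.Iio (t - 2 * n - 1)) := by
    rw [← measure_congr (show (A ∩ {t - 2 * n - 1}ᶜ : Set ℝ) =ᵐ[volume] A from ?_)]
    · refine le_trans (measure_mono ?_) (measure_union_le _ _)
      rintro s ⟨hs, hs'⟩
      rcases lt_or_gt_of_ne hs' with h | h
      · exact Or.inr ⟨hs, h⟩
      · exact Or.inl ⟨hs, h⟩
    · filter_upwards [Measure.ae_ne volume (t - 2 * n - 1)] with s hs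
      exact propext ⟨fun h => h.1, fun h => ⟨h, hs⟩⟩
  have hhalf : volume A / 2 ≤ volume (A ∩ Set.Ioi (t - 2 * n - 1)) ∨
      volume A / 2 ≤ volume (A ∩ Set.Iio (t - 2 * n - 1)) := by
    by_contra! h
    have := ENNReal.add_lt_add h.1 h.2
    rw [ENNReal.add_halves] at this
    exact (hsplit.trans_lt this).false
  rcases hhalf with h | h
  · refine main n _ le_rfl (Nat.le_succ n) (hAm.inter measurableSet_Ioi.nullMeasurableSet)
      Set.inter_subset_left (fun s hs => ?_) h
    have h1 := hs.1.1.2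
    have h2 : t - 2 * n - 1 < s := hs.2
    constructor <;> linarith
  · refine main (n + 1) _ (Nat.le_succ n) le_rfl (hAm.inter measurableSet_Iio.nullMeasurableSet)
      Set.inter_subset_left (fun s hs => ?_) h
    have h1 := hs.1.1.1
    have h2 : s < t - 2 * n - 1 := hs.2
    push_cast
    constructor <;> linarith

end BoundaryDamping

theorem mainTheorem7 (S : Set (ℝ × ℝ)) (M : ℝ) (q : ℝ → ℝ)
    (hS : BoundaryDamping.IsDamping S)
    (hinf : BoundaryDamping.SectorAtInfinity S M)
    (hdiag : S ∩ {w | w.1 = w.2} = {((0 : ℝ), (0 : ℝ))})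
    (hq : BoundaryDamping.IsProfile q)
    (hSq : ∀ w ∈ S ∩ BoundaryDamping.ball M, |w.2| = q |w.1| ∨ |w.1| = q |w.2|)
    (p : ℝ≥0∞) (hp : 1 ≤ p)
    (z₀ z₁ : ℝ → ℝ) (z : ℝ → ℝ → ℝ)
    (hz : BoundaryDamping.IsWeakSolution p S z₀ z₁ z)
    (hz_ne : BoundaryDamping.Nontrivial z) :
    ∃ C₁ C₂ : ℝ, 0 < C₁ ∧ 0 < C₂ ∧ ∀ t : ℝ, 0 ≤ t →
      ENNReal.ofReal (C₁ * (BoundaryDamping.transform q)^[⌊t / 2⌋₊] 1)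
          ≤ BoundaryDamping.energy p z t ∧
        BoundaryDamping.energy p z t
          ≤ ENNReal.ofReal (C₂ * (BoundaryDamping.transform q)^[⌊t / 2⌋₊] 1) := by
  obtain ⟨l, hl0, hl1, hstep⟩ := BoundaryDamping.exists_isStep hinf hdiag hq hSq
  have hm : 0 < M / Real.sqrt 2 := div_pos hinf.2.1 (by positivity)
  obtain ⟨g, hg⟩ := hz.exists_profile hp
  obtain ⟨C₁, h1, hlow⟩ := hg.le_energy hp hq.slowMap hm hl0 hl1 hstep hz_ne
  obtain ⟨C₂, h2, hup⟩ := hg.energy_le hp hq.slowMap hm hl0 hl1 hstep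
  exact ⟨C₁, C₂, h1, h2, fun t ht => ⟨hlow t ht, hup t ht⟩⟩
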